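/- **Definitions.** Let $G$ be a finite group acting faithfully on a finite set $\Omega$. For $\Lambda\subseteq\Omega$ let $G_{(\Lambda)}$ be its pointwise stabilizer. $\Lambda$ is a *base* if $G_{(\Lambda)}=\{1\}$; it is a *minimal base* if moreover no proper subset of $\Lambda$ is a base; it is *independent* if $G_{(\Lambda)}\neq G_{(\Lambda')}$ for every proper subset $\Lambda'\subsetneq\Lambda$. A sequence $[\omega_1,\dots,\omega_\ell]$ of elements of $\Omega$ is an *irredundant base* (of length $\ell$) if $$G\gneq G_{\omega_1}\gneq G_{\omega_1,\omega_2}\gneq\cdots\gneq G_{\omega_1,\dots,\omega_\ell}=\{1\}.$$ Let $\mathrm{B}(G,\Omega)$ be the maximum size of a minimal base, $\mathrm{H}(G,\Omega)$ (the *height*) the maximum size of an independent set, and $\mathrm{I}(G,\Omega)$ the maximum length of an irredundant base. **Theorem.** Let $k$ and $n$ be positive integers with $1\le k\le \frac n2$, and let $S_n$ act in the natural way on $\Omega_k$, the set of $k$-subsets of $\{1,\dots,n\}$. Then: 1. $\mathrm{I}(S_n,\Omega_k)=\begin{cases} n-1, & \text{if } \gcd(n,k)=1;\\ n-2, & \text{otherwise.}\end{cases}$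 2. $\mathrm{B}(S_n,\Omega_k)=\mathrm{H}(S_n,\Omega_k)=\begin{cases} n-1, & \text{if } k=1;\\ n-2, & \text{if } k=2, \text{ or if } k\ge 3 \text{ and } n=2k+2;\\ n-3, & \text{otherwise.}\end{cases}$ -/

import Mathlib

/-!
Statistics of a group `G` acting on a set `Ω`.  The pointwise stabilizer of `Λ ⊆ Ω` is Mathlib's
`fixingSubgroup G Λ`.
-/

/-- `Λ` is a base: its pointwise stabilizer is trivial. -/
def IsActionBase (G : Type*) {Ω : Type*} [Group G] [MulAction G Ω] (Λ : Set Ω) : Prop :=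
  fixingSubgroup G Λ = ⊥

/-- `Λ` is a minimal base: a base none of whose proper subsets is a base. -/
def IsMinimalBase (G : Type*) {Ω : Type*} [Group G] [MulAction G Ω] (Λ : Set Ω) : Prop :=
  IsActionBase G Λ ∧ ∀ Λ' : Set Ω, Λ' ⊂ Λ → ¬ IsActionBase G Λ'

/-- `Λ` is independent: its pointwise stabilizer differs from that of every proper subset. -/
def IsIndependentSet (G : Type*) {Ω : Type*} [Group G] [MulAction G Ω] (Λ : Set Ω) : Prop :=
  ∀ Λ' : Set Ω, Λ' ⊂ Λ → fixingSubgroup G Λ ≠ fixingSubgroup G Λ'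

/-- The sequence `[ω 0, …, ω (ℓ - 1)]` is an irredundant base: all inclusions of its stabilizer
chain `G ≥ G_{ω 0} ≥ G_{ω 0, ω 1} ≥ ⋯` are strict, and the last group of the chain is trivial. -/
def IsIrredundantBase (G : Type*) {Ω : Type*} [Group G] [MulAction G Ω] {ℓ : ℕ}
    (ω : Fin ℓ → Ω) : Prop :=
  (∀ i : Fin ℓ, fixingSubgroup G (ω '' Set.Iic i) < fixingSubgroup G (ω '' Set.Iio i)) ∧
    fixingSubgroup G (Set.range ω) = ⊥

/-- `B(G, Ω) = b`: the maximum size of a minimal base exists and equals `b`. -/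
def MaxMinimalBaseSizeEq (G Ω : Type*) [Group G] [MulAction G Ω] (b : ℕ) : Prop :=
  IsGreatest {m : ℕ | ∃ Λ : Finset Ω, IsMinimalBase G (Λ : Set Ω) ∧ Λ.card = m} b

/-- `H(G, Ω) = h`: the maximum size of an independent set exists and equals `h`. -/
def HeightEq (G Ω : Type*) [Group G] [MulAction G Ω] (h : ℕ) : Prop :=
  IsGreatest {m : ℕ | ∃ Λ : Finset Ω, IsIndependentSet G (Λ : Set Ω) ∧ Λ.card = m} h

/-- `I(G, Ω) = ℓ`: the maximum length of an irredundant base exists and equals `ℓ`. -/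
def MaxIrredundantBaseLengthEq (G Ω : Type*) [Group G] [MulAction G Ω] (ℓ : ℕ) : Prop :=
  IsGreatest {m : ℕ | ∃ ω : Fin m → Ω, IsIrredundantBase G ω} ℓ

/-! A permutation fixes every member of a family of `k`-sets exactly when it preserves each class of
points not separated by the family. The stabilizer is thus a product of symmetric groups, determined
by the transpositions it contains, and everything becomes a question about separating pairs of
points.

For `I`, each set in a chain separates a pair that earlier sets do not. Hence the indicators
together with the all-ones vector are linearly independent over any field, so the length is at most
`n - 1`. If a prime `p` divides `n` and `k`, all these vectors lie in the sum-zero hyperplane over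
`ZMod p`, which costs one more. Conversely, sets are added greedily, each splitting a single class
in two (`exists_powersetCard_splitting_fiber`). This can fail only if all classes have one common
size `> 1` dividing both `n` and `k`.

For `B` and `H`, every member of an independent family has a private pair, separated by it alone.
These pairs are the edges of a forest, so the size of the family is at most `n` minus the number of
components. Toggling a leaf in the set of its edge gives a union of components
(`PrivatePairs.exists_leaf`). Counting then rules out one component when `k ≥ 2`, and two components
when `k ≥ 3` unless `n = 2k + 2`. Explicit minimal bases attain the bounds. -/

/-! ### Stabilizers in terms of separated pairs -/

section Separation

variable {n k : ℕ}

/-- Two points are not separated by any member of a family of `k`-sets. -/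
def Indisting (Λ : Set (Set.powersetCard (Fin n) k)) (x y : Fin n) : Prop :=
  ∀ A ∈ Λ, x ∈ A ↔ y ∈ A

theorem smul_powersetCard_eq_iff (g : Equiv.Perm (Fin n)) (A : Set.powersetCard (Fin n) k) :
    g • A = A ↔ ∀ x, x ∈ A ↔ g x ∈ A := by
  rw [← Subtype.coe_inj, Set.powersetCard.coe_smul, Finset.ext_iff]
  constructor
  · intro h x
    have := h (g x)
    rwa [← Equiv.Perm.smul_def, Finset.smul_mem_smul_finset_iff, Set.powersetCard.mem_coe_iff,
      Set.powersetCard.mem_coe_iff] at this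
  · intro h x
    obtain ⟨y, rfl⟩ := g.surjective x
    rw [← Equiv.Perm.smul_def, Finset.smul_mem_smul_finset_iff]
    exact h y

theorem mem_fixingSubgroup_powersetCard_iff {Λ : Set (Set.powersetCard (Fin n) k)}
    {g : Equiv.Perm (Fin n)} :
    g ∈ fixingSubgroup (Equiv.Perm (Fin n)) Λ ↔ ∀ x, Indisting Λ x (g x) := by
  simp only [mem_fixingSubgroup_iff, smul_powersetCard_eq_iff, Indisting]
  exact ⟨fun h x A hA => h A hA x, fun h A hA x => h x A hA⟩

theorem swap_mem_fixingSubgroup_iff {Λ : Set (Set.powersetCard (Fin n) k)} {x y : Fin n} :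
    Equiv.swap x y ∈ fixingSubgroup (Equiv.Perm (Fin n)) Λ ↔ Indisting Λ x y := by
  rw [mem_fixingSubgroup_powersetCard_iff]
  constructor
  · intro h
    simpa using h x
  · intro h z A hA
    by_cases hx : z = x
    · subst hx; simpa using h A hA
    by_cases hy : z = y
    · subst hy; simpa using (h A hA).symm
    rw [Equiv.swap_apply_of_ne_of_ne hx hy]

/-- Transpositions suffice to compare stabilizers, since membership of `g` depends only on the pairs
`x`, `g x`. -/
theorem fixingSubgroup_le_iff {Λ Λ' : Set (Set.powersetCard (Fin n) k)} :
    fixingSubgroup (Equiv.Perm (Fin n)) Λ ≤ fixingSubgroup (Equiv.Perm (Fin n)) Λ' ↔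
      ∀ x y, Indisting Λ x y → Indisting Λ' x y := by
  constructor
  · intro h x y hxy
    exact swap_mem_fixingSubgroup_iff.mp (h (swap_mem_fixingSubgroup_iff.mpr hxy))
  · intro h g hg
    rw [mem_fixingSubgroup_powersetCard_iff] at hg ⊢
    exact fun x => h _ _ (hg x)

theorem isActionBase_iff {Λ : Set (Set.powersetCard (Fin n) k)} :
    IsActionBase (Equiv.Perm (Fin n)) Λ ↔ ∀ x y, Indisting Λ x y → x = y := by
  constructor
  · intro h x y hxy
    have := swap_mem_fixingSubgroup_iff.mpr hxy
    rwa [h, Subgroup.mem_bot, Equiv.swap_eq_one_iff] at this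
  · intro h
    refine (Subgroup.eq_bot_iff_forall _).mpr fun g hg => ?_
    rw [mem_fixingSubgroup_powersetCard_iff] at hg
    exact Equiv.ext fun x => (h _ _ (hg x)).symm

/-- Stabilizers shrink as families grow, so only the removal of a single set `A` has to be tested; a
transposition gained by the removal is a private pair of `A`. -/
theorem isIndependentSet_iff {Λ : Set (Set.powersetCard (Fin n) k)} :
    IsIndependentSet (Equiv.Perm (Fin n)) Λ ↔
      ∀ A ∈ Λ, ∃ x y, x ∈ A ∧ y ∉ A ∧ ∀ B ∈ Λ, B ≠ A → (x ∈ B ↔ y ∈ B) := by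
  constructor
  · intro h A hA
    have h1 := h (Λ \ {A}) (Set.sdiff_singleton_ssubset.mpr hA)
    have h2 : ¬ fixingSubgroup (Equiv.Perm (Fin n)) (Λ \ {A}) ≤
        fixingSubgroup (Equiv.Perm (Fin n)) Λ := fun h3 =>
      h1 (le_antisymm (fixingSubgroup_antitone _ _ Set.sdiff_subset) h3)
    rw [fixingSubgroup_le_iff] at h2
    push Not at h2
    obtain ⟨x, y, hxy, hn⟩ := h2
    have hB : ∀ B ∈ Λ, B ≠ A → (x ∈ B ↔ y ∈ B) := fun B hB hne => hxy B ⟨hB, hne⟩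
    have hA' : ¬ (x ∈ A ↔ y ∈ A) := by
      intro h3
      refine hn fun B hB' => ?_
      by_cases hBA : B = A
      · rw [hBA]; exact h3
      · exact hB B hB' hBA
    by_cases hx : x ∈ A
    · exact ⟨x, y, hx, fun hy => hA' (by tauto), hB⟩
    · exact ⟨y, x, by tauto, hx, fun B h1 h2 => (hB B h1 h2).symm⟩
  · intro h Λ' hΛ' heq
    obtain ⟨A, hA, hA'⟩ := Set.exists_of_ssubset hΛ'
    obtain ⟨x, y, hx, hy, hB⟩ := h A hA
    have h1 : Indisting Λ' x y := fun B hB' =>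
      hB B (hΛ'.subset hB') (fun h => hA' (h ▸ hB'))
    have h2 := fixingSubgroup_le_iff.mp heq.symm.le x y h1 A hA
    exact hy (h2.mp hx)

theorem isMinimalBase_iff {Λ : Set (Set.powersetCard (Fin n) k)} :
    IsMinimalBase (Equiv.Perm (Fin n)) Λ ↔
      IsActionBase (Equiv.Perm (Fin n)) Λ ∧ IsIndependentSet (Equiv.Perm (Fin n)) Λ := by
  refine and_congr_right fun hb => ⟨fun h Λ' hΛ' heq => h Λ' hΛ' ?_, fun h Λ' hΛ' hb' => ?_⟩
  · exact heq.symm.trans hb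
  · exact h Λ' hΛ' (hb.trans hb'.symm)

theorem isIrredundantBase_iff {m : ℕ} {ω : Fin m → Set.powersetCard (Fin n) k} :
    IsIrredundantBase (Equiv.Perm (Fin n)) ω ↔
      (∀ i, ∃ x y, x ∈ ω i ∧ y ∉ ω i ∧ ∀ j < i, (x ∈ ω j ↔ y ∈ ω j)) ∧
        ∀ x y, (∀ i, x ∈ ω i ↔ y ∈ ω i) → x = y := by
  refine and_congr (forall_congr' fun i => ?_) ?_
  · rw [lt_iff_le_not_ge, fixingSubgroup_le_iff, fixingSubgroup_le_iff]
    simp only [Indisting, Set.forall_mem_image, Set.mem_Iic, Set.mem_Iio]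
    constructor
    · rintro ⟨-, h⟩
      push Not at h
      obtain ⟨x, y, hxy, j, hj, hj'⟩ := h
      have hji : j = i := by
        rcases hj.lt_or_eq with h | h
        · have := hxy h; tauto
        · exact h
      subst hji
      rcases hj' with h | h
      · exact ⟨x, y, h.1, h.2, fun j hj => hxy hj⟩
      · exact ⟨y, x, h.2, h.1, fun j hj => (hxy hj).symm⟩
    · rintro ⟨x, y, hx, hy, h⟩
      refine ⟨fun x y h j hj => h hj.le, fun h' => ?_⟩
      exact hy ((h' x y (fun j hj => h j hj) le_rfl).mp hx)
  · have := isActionBase_iff (Λ := Set.range ω)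
    simpa only [IsActionBase, Indisting, Set.forall_mem_range] using this

end Separation

/-! ### Upper bounds for irredundant bases by linear algebra -/

section IrredundantUpper

variable {n k : ℕ}

open Classical in
/-- The all-ones vector followed by the indicator vectors of a sequence of `k`-sets. -/
noncomputable def onesAndIndicators (F : Type*) [Field F] {m : ℕ}
    (ω : Fin m → Set.powersetCard (Fin n) k) : Fin (m + 1) → Fin n → F :=
  Fin.cons (fun _ => 1) fun i x => if x ∈ ω i then 1 else 0

theorem init_onesAndIndicators (F : Type*) [Field F] {m : ℕ}
    (ω : Fin (m + 1) → Set.powersetCard (Fin n) k) :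
    Fin.init (onesAndIndicators F ω) = onesAndIndicators F fun i => ω i.castSucc := by
  funext i
  refine Fin.cases ?_ (fun i => ?_) i
  · rfl
  · simp only [onesAndIndicators, Fin.init, ← Fin.succ_castSucc, Fin.cons_succ]

theorem linearIndependent_onesAndIndicators (F : Type*) [Field F] (hn : 0 < n) {m : ℕ}
    (ω : Fin m → Set.powersetCard (Fin n) k)
    (h : ∀ i, ∃ x y, x ∈ ω i ∧ y ∉ ω i ∧ ∀ j < i, (x ∈ ω j ↔ y ∈ ω j)) :
    LinearIndependent F (onesAndIndicators F ω) := by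
  classical
  induction m with
  | zero =>
    have : Subsingleton (Fin (0 + 1)) := inferInstanceAs (Subsingleton (Fin 1))
    rw [linearIndependent_subsingleton_index_iff]
    intro i h0
    obtain rfl := Subsingleton.elim i 0
    exact one_ne_zero (α := F) (congrFun h0 ⟨0, hn⟩)
  | succ m ih =>
    rw [linearIndependent_finSucc', init_onesAndIndicators]
    constructor
    · refine ih _ fun i => ?_
      obtain ⟨x, y, hx, hy, hj⟩ := h i.castSucc
      exact ⟨x, y, hx, hy, fun j hj' => hj _ (Fin.castSucc_lt_castSucc_iff.mpr hj')⟩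
    · obtain ⟨x, y, hx, hy, hj⟩ := h (Fin.last m)
      intro hmem
      -- All earlier vectors agree at `x` and `y`, so their span does too; the last indicator does
      -- not.
      have hle : Submodule.span F (Set.range (onesAndIndicators F fun i => ω i.castSucc)) ≤
          LinearMap.ker ((LinearMap.proj x : (Fin n → F) →ₗ[F] F) - LinearMap.proj y) := by
        rw [Submodule.span_le]
        rintro _ ⟨i, rfl⟩
        refine Fin.cases ?_ (fun i => ?_) i
        · simp [onesAndIndicators]
        · have := hj i.castSucc (Fin.castSucc_lt_last i)
          simp [onesAndIndicators, this]
      have := hle hmem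
      rw [← Fin.succ_last] at this
      simp [onesAndIndicators, hx, hy] at this

theorem irredundant_length_lt (hn : 0 < n) {m : ℕ} (ω : Fin m → Set.powersetCard (Fin n) k)
    (h : ∀ i, ∃ x y, x ∈ ω i ∧ y ∉ ω i ∧ ∀ j < i, (x ∈ ω j ↔ y ∈ ω j)) : m < n := by
  simpa using (linearIndependent_onesAndIndicators ℚ hn ω h).fintype_card_le_finrank

theorem irredundant_length_add_one_lt (hn : 0 < n) (hgcd : Nat.gcd n k ≠ 1) {m : ℕ}
    (ω : Fin m → Set.powersetCard (Fin n) k)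
    (h : ∀ i, ∃ x y, x ∈ ω i ∧ y ∉ ω i ∧ ∀ j < i, (x ∈ ω j ↔ y ∈ ω j)) : m + 1 < n := by
  classical
  obtain ⟨p, hp, hpd⟩ := Nat.exists_prime_and_dvd hgcd
  have := Fact.mk hp
  have hpn : (n : ZMod p) = 0 :=
    (ZMod.natCast_eq_zero_iff _ _).mpr (hpd.trans (Nat.gcd_dvd_left _ _))
  have hpk : (k : ZMod p) = 0 :=
    (ZMod.natCast_eq_zero_iff _ _).mpr (hpd.trans (Nat.gcd_dvd_right _ _))
  have hli := linearIndependent_onesAndIndicators (ZMod p) hn ω h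
  have hlt := irredundant_length_lt hn ω h
  rcases Nat.lt_or_ge (m + 1) n with h1 | h1
  · exact h1
  exfalso
  have hmn : Fintype.card (Fin (m + 1)) = Module.finrank (ZMod p) (Fin n → ZMod p) := by
    simp; omega
  have hspan := hli.span_eq_top_of_card_eq_finrank' hmn
  -- The coordinate sums are `n` and `k`, both zero mod `p`, so `n` such vectors cannot span.
  have hle : (⊤ : Submodule (ZMod p) (Fin n → ZMod p)) ≤
      LinearMap.ker (∑ x, LinearMap.proj x : (Fin n → ZMod p) →ₗ[ZMod p] ZMod p) := by
    rw [← hspan, Submodule.span_le]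
    rintro _ ⟨i, rfl⟩
    refine Fin.cases ?_ (fun i => ?_) i
    · simp [onesAndIndicators, hpn]
    · have : (Finset.univ.filter fun x => x ∈ ω i) = (ω i : Finset (Fin n)) := by
        ext x; simp [Set.powersetCard.mem_coe_iff]
      simp [onesAndIndicators, this, hpk]
  have := hle (Submodule.mem_top : Pi.single ⟨0, hn⟩ 1 ∈ _)
  simp [Finset.sum_pi_single'] at this

end IrredundantUpper

/-! ### Construction of long irredundant bases -/

section IrredundantLower

variable {n k c : ℕ}

/-- If the fibres of `f` are not all of the same size dividing both `n` and `k`, some `k`-set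
splits exactly one fibre of `f`. -/
theorem exists_powersetCard_splitting_fiber (hk : 0 < k) (hkn : k < n) (f : Fin n → Fin c)
    (hf : Function.Surjective f) (hfi : ¬ Function.Injective f)
    (hc : Nat.gcd n k = 1 ∨ ∃ x, ∀ y, f y = f x → y = x) :
    ∃ A : Set.powersetCard (Fin n) k, ∃ x₀ y₀, f x₀ = f y₀ ∧ x₀ ∈ A ∧ y₀ ∉ A ∧
      ∀ x y, f x = f y → f x ≠ f x₀ → (x ∈ A ↔ y ∈ A) := by
  classical
  by_contra hcon
  set s : Fin c → ℕ := fun q => (Finset.univ.filter fun x => f x = q).card with hs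
  have hsum : ∀ Q : Finset (Fin c),
      (Finset.univ.filter fun x => f x ∈ Q).card = ∑ q ∈ Q, s q := by
    intro Q
    rw [Finset.card_eq_sum_card_fiberwise (f := f) (t := Q) (by intro x; simp)]
    refine Finset.sum_congr rfl fun q hq => ?_
    congr 1
    ext x
    simp only [Finset.mem_filter, Finset.mem_univ, true_and]
    exact ⟨fun h => h.2, fun h => ⟨h ▸ hq, h⟩⟩
  -- A union of fibres that is too small, but too large once fibre `q` is added, could be filled up
  -- to size `k` with part of `q`, splitting `q` alone.
  have hstuck : ∀ Q : Finset (Fin c), ∀ q ∉ Q, ∑ i ∈ Q, s i < k → k < ∑ i ∈ Q, s i + s q →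
      False := by
    intro Q q hq h1 h2
    obtain ⟨B, hB, hBc⟩ := Finset.exists_subset_card_eq
      (s := Finset.univ.filter fun x => f x = q) (n := k - ∑ i ∈ Q, s i)
      (by change _ ≤ s q; omega)
    have hBq : ∀ x ∈ B, f x = q := fun x hx => by simpa using hB hx
    have hdisj : Disjoint (Finset.univ.filter fun x => f x ∈ Q) B := by
      rw [Finset.disjoint_left]
      intro x hx hxB
      rw [Finset.mem_filter, hBq x hxB] at hx
      exact hq hx.2
    have hcard : ((Finset.univ.filter fun x => f x ∈ Q) ∪ B).card = k := by
      rw [Finset.card_union_of_disjoint hdisj, hsum, hBc]; omega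
    obtain ⟨x₀, hx₀⟩ : B.Nonempty := by
      rw [← Finset.card_pos]; omega
    obtain ⟨y₀, hy₀, hy₀B⟩ : ∃ y ∈ Finset.univ.filter fun x => f x = q, y ∉ B := by
      apply Finset.exists_mem_notMem_of_card_lt_card
      change _ < s q
      omega
    have hy₀q : f y₀ = q := by simpa using hy₀
    refine hcon ⟨⟨_, hcard⟩, x₀, y₀, (hBq _ hx₀).trans hy₀q.symm, ?_, ?_, ?_⟩
    · rw [← Set.powersetCard.mem_coe_iff]
      exact Finset.mem_union_right _ hx₀
    · rw [← Set.powersetCard.mem_coe_iff]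
      simp [hy₀B, hy₀q, hq]
    · intro x y hxy hne
      rw [hBq _ hx₀] at hne
      have hx : x ∉ B := fun h => hne (hBq _ h)
      have hy : y ∉ B := fun h => hne (hxy.trans (hBq _ h))
      rw [← Set.powersetCard.mem_coe_iff, ← Set.powersetCard.mem_coe_iff]
      simp [hx, hy, hxy]
  have htot : ∑ q, s q = n := by
    rw [← hsum]; simp
  -- A union of size at most `k` with the most fibres must have size exactly `k`: otherwise any
  -- further fibre overshoots.
  obtain ⟨Q, hQ⟩ : ∃ Q : Finset (Fin c), ∑ i ∈ Q, s i = k := by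
    obtain ⟨Q, hQm, hQmax⟩ := Finset.exists_max_image
      (Finset.univ.filter fun Q : Finset (Fin c) => ∑ i ∈ Q, s i ≤ k) (fun Q => Q.card)
      ⟨∅, by simp⟩
    simp only [Finset.mem_filter, Finset.mem_univ, true_and] at hQm hQmax
    refine ⟨Q, hQm.eq_of_not_lt fun hlt => ?_⟩
    obtain ⟨q, hq⟩ : ∃ q, q ∉ Q := by
      by_contra! hall
      rw [Finset.eq_univ_iff_forall.mpr hall, htot] at hlt
      omega
    refine hstuck Q q hq hlt ?_
    by_contra! hle
    have := hQmax (insert q Q) (by rw [Finset.sum_insert hq]; omega)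
    rw [Finset.card_insert_of_notMem hq] at this
    omega
  -- Exchange: if `b` is larger than `a`, replacing `a` by `b` overshoots `k`; if smaller, the
  -- replacement falls short and adding `a` back overshoots.
  have heq : ∀ a ∈ Q, ∀ b ∉ Q, s a = s b := by
    intro a ha b hb
    have hpos : ∀ q, 0 < s q := fun q => by
      obtain ⟨x, rfl⟩ := hf q
      exact Finset.card_pos.mpr ⟨x, by simp⟩
    have hpa := hpos a
    have hpb := hpos b
    have h1 := Finset.sum_erase_add Q s ha
    have hbe : b ∉ Q.erase a := fun h => hb (Finset.mem_of_mem_erase h)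
    have hle : s b ≤ s a := by
      by_contra! hlt
      exact hstuck (Q.erase a) b hbe (by omega) (by omega)
    refine le_antisymm ?_ hle
    by_contra! hlt
    have hab : a ≠ b := fun h => hb (h ▸ ha)
    refine hstuck (insert b (Q.erase a)) a (by simp [hab]) ?_ ?_ <;>
      rw [Finset.sum_insert hbe] <;> omega
  obtain ⟨a₀, ha₀⟩ : Q.Nonempty := by
    rw [Finset.nonempty_iff_ne_empty]
    rintro rfl
    simp at hQ; omega
  obtain ⟨b₀, hb₀⟩ : ∃ q, q ∉ Q := by
    by_contra! hall
    rw [Finset.eq_univ_iff_forall.mpr hall, htot] at hQ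
    omega
  have hall : ∀ q, s q = s a₀ := by
    intro q
    by_cases hq : q ∈ Q
    · rw [heq q hq b₀ hb₀, heq a₀ ha₀ b₀ hb₀]
    · rw [heq a₀ ha₀ q hq]
  have hone : s a₀ = 1 := by
    rcases hc with hc | ⟨x, hx⟩
    · have hdn : s a₀ ∣ n := by
        rw [← htot]
        exact Finset.dvd_sum fun q _ => (hall q).symm.dvd
      have hdk : s a₀ ∣ k := by
        rw [← hQ]
        exact Finset.dvd_sum fun q _ => (hall q).symm.dvd
      exact Nat.dvd_one.mp (hc ▸ Nat.dvd_gcd hdn hdk)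
    · rw [← hall (f x), hs]
      simp only
      rw [Finset.card_eq_one]
      refine ⟨x, ?_⟩
      ext y
      simp only [Finset.mem_filter, Finset.mem_univ, true_and, Finset.mem_singleton]
      exact ⟨hx y, fun h => h ▸ rfl⟩
  refine hfi fun x y hxy => ?_
  have h1 : s (f y) ≤ 1 := by rw [hall, hone]
  exact Finset.card_le_one.mp h1 x (by simpa using hxy) y (by simp)

/-- A sequence of `k`-sets with strict stabilizer chain whose separation classes are the fibres of
a labelling `f` extends to an irredundant base by adding one set for each missing class. -/
theorem exists_irredundantBase_extending (hk : 0 < k) (hkn : k < n) (d : ℕ) :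
    ∀ (m c : ℕ), c + d = n → ∀ (ω : Fin m → Set.powersetCard (Fin n) k) (f : Fin n → Fin c),
      (∀ i, ∃ x y, x ∈ ω i ∧ y ∉ ω i ∧ ∀ j < i, (x ∈ ω j ↔ y ∈ ω j)) →
      Function.Surjective f → (∀ x y, (∀ i, x ∈ ω i ↔ y ∈ ω i) ↔ f x = f y) →
      (Nat.gcd n k = 1 ∨ ∃ x, ∀ y, f y = f x → y = x) →
      ∃ ω' : Fin (m + d) → Set.powersetCard (Fin n) k,
        IsIrredundantBase (Equiv.Perm (Fin n)) ω' := by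
  classical
  induction d with
  | zero =>
    intro m c hcd ω f hω hf hωf _
    refine ⟨ω, isIrredundantBase_iff.mpr ⟨hω, fun x y h => ?_⟩⟩
    have hbij := (Fintype.bijective_iff_surjective_and_card f).mpr ⟨hf, by simp; omega⟩
    exact hbij.1 ((hωf x y).mp h)
  | succ d ih =>
    intro m c hcd ω f hω hf hωf hc
    have hfi : ¬ Function.Injective f := fun h => by
      have := Fintype.card_le_of_injective f h
      simp at this
      omega
    obtain ⟨A, x₀, y₀, hxy₀, hx₀, hy₀, hA⟩ :=
      exists_powersetCard_splitting_fiber hk hkn f hf hfi hc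
    rw [show m + (d + 1) = (m + 1) + d by omega]
    -- The half of the split fibre inside `A` gets the new label. Refinement keeps singleton fibres,
    -- so `hc` survives the induction.
    let g : Fin n → Fin (c + 1) := fun x =>
      if x ∈ A ∧ f x = f x₀ then Fin.last c else (f x).castSucc
    have hgf : ∀ x y, g x = g y ↔ (f x = f y ∧ (x ∈ A ↔ y ∈ A)) := by
      intro x y
      have hcl := fun z => (Fin.castSucc_lt_last (f z)).ne
      simp only [g]
      split_ifs with h1 h2 h2
      · exact iff_of_true rfl ⟨h1.2.trans h2.2.symm, iff_of_true h1.1 h2.1⟩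
      · refine iff_of_false (hcl y).symm fun h => h2 ⟨h.2.mp h1.1, h.1 ▸ h1.2⟩
      · refine iff_of_false (hcl x) fun h => h1 ⟨h.2.mpr h2.1, h.1 ▸ h2.2⟩
      · rw [Fin.castSucc_inj]
        refine ⟨fun h => ⟨h, ?_⟩, fun h => h.1⟩
        by_cases hx : f x = f x₀
        · have := h ▸ hx
          tauto
        · exact hA x y h hx
    refine ih (m + 1) (c + 1) (by omega) (Fin.snoc ω A) g ?_ ?_ ?_ ?_
    · intro i
      refine Fin.lastCases ?_ (fun i => ?_) i
      · refine ⟨x₀, y₀, by simpa using hx₀, by simpa using hy₀, fun j hj => ?_⟩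
        obtain ⟨j, rfl⟩ := Fin.exists_castSucc_eq.mpr hj.ne
        simpa using (hωf x₀ y₀).mpr hxy₀ j
      · obtain ⟨x, y, hx, hy, h⟩ := hω i
        refine ⟨x, y, by simpa using hx, by simpa using hy, fun j hj => ?_⟩
        obtain ⟨j, rfl⟩ := Fin.exists_castSucc_eq.mpr (hj.trans (Fin.castSucc_lt_last i)).ne
        simpa using h j (by simpa using hj)
    · intro q
      refine Fin.lastCases ?_ (fun q => ?_) q
      · exact ⟨x₀, by simp [g, hx₀]⟩
      · obtain ⟨x, rfl⟩ := hf q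
        by_cases hx : f x = f x₀
        · exact ⟨y₀, by simp [g, hy₀, hx, hxy₀]⟩
        · exact ⟨x, by simp [g, hx]⟩
    · intro x y
      rw [hgf, ← hωf, Fin.forall_fin_succ']
      simp
    · refine hc.imp_right fun ⟨x, hx⟩ => ⟨x, fun y hy => hx y ((hgf y x).mp hy).1⟩

theorem maxIrredundantBaseLengthEq_powersetCard (hk : 1 ≤ k) (hkn : 2 * k ≤ n) :
    MaxIrredundantBaseLengthEq (Equiv.Perm (Fin n)) (Set.powersetCard (Fin n) k)
      (if Nat.gcd n k = 1 then n - 1 else n - 2) := by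
  have hn : 0 < n := by omega
  split_ifs with hgcd
  · constructor
    · obtain ⟨d, rfl⟩ : ∃ d, n = 1 + d := ⟨n - 1, by omega⟩
      obtain ⟨ω, hω⟩ := exists_irredundantBase_extending (n := 1 + d) (k := k) hk (by omega) d 0 1 rfl
        Fin.elim0 (fun _ => 0) (fun i => i.elim0)
        (fun q => ⟨⟨0, hn⟩, Subsingleton.elim _ _⟩)
        (fun x y => iff_of_true (fun i => i.elim0) rfl) (Or.inl hgcd)
      rw [show 1 + d - 1 = 0 + d by omega]
      exact ⟨ω, hω⟩
    · rintro m ⟨ω, hω⟩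
      have := irredundant_length_lt hn ω (isIrredundantBase_iff.mp hω).1
      omega
  · constructor
    · have hk2 : 2 ≤ k := by
        by_contra! h
        obtain rfl : k = 1 := by omega
        simp at hgcd
      -- Two overlapping intervals produce four classes, among them the singleton `{0}` that keeps
      -- the greedy process going. Two sets for four classes is the single loss against `n - 1`.
      let A : Set.powersetCard (Fin n) k :=
        ⟨Finset.univ.filter fun x => x.val < k, by
          simp [Set.powersetCard.mem_iff, Fin.card_filter_val_lt]; omega⟩
      let B : Set.powersetCard (Fin n) k :=
        ⟨Finset.Icc ⟨1, by omega⟩ ⟨k, by omega⟩, by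
          simp [Set.powersetCard.mem_iff]⟩
      have hA : ∀ x, x ∈ A ↔ x.val < k := fun x => by
        rw [← Set.powersetCard.mem_coe_iff]; simp [A]
      have hB : ∀ x, x ∈ B ↔ 1 ≤ x.val ∧ x.val ≤ k := fun x => by
        rw [← Set.powersetCard.mem_coe_iff]; simp [B, Fin.le_def]
      let f : Fin n → Fin 4 := fun x =>
        if x.val = 0 then 0 else if x.val < k then 1 else if x.val = k then 2 else 3
      obtain ⟨d, hd⟩ : ∃ d, 4 + d = n := ⟨n - 4, by omega⟩
      rw [show n - 2 = 2 + d by omega]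
      refine exists_irredundantBase_extending (n := n) (k := k) hk (by omega) d 2 4 hd
        ![A, B] f ?_ ?_ ?_ (Or.inr ⟨⟨0, hn⟩, ?_⟩)
      · intro i
        fin_cases i
        · exact ⟨⟨0, hn⟩, ⟨k, by omega⟩, by simp [hA]; omega, by simp [hA], by simp⟩
        · refine ⟨⟨1, by omega⟩, ⟨0, hn⟩, by simp [hB]; omega, by simp [hB], fun j hj => ?_⟩
          obtain rfl : j = 0 := by simpa using hj
          simp [hA]; omega
      · intro q
        fin_cases q
        · exact ⟨⟨0, hn⟩, by simp [f]⟩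
        · exact ⟨⟨1, by omega⟩, by simp [f]; omega⟩
        · exact ⟨⟨k, by omega⟩, by simp [f]; omega⟩
        · exact ⟨⟨k + 1, by omega⟩, by simp [f]⟩
      · intro x y
        simp only [Fin.forall_fin_two, Matrix.cons_val_zero, Matrix.cons_val_one, hA, hB, f]
        split_ifs <;> simp <;> omega
      · intro y
        simp only [f, Fin.ext_iff]
        split_ifs <;> simp [*]
    · rintro m ⟨ω, hω⟩
      have := irredundant_length_add_one_lt hn hgcd ω (isIrredundantBase_iff.mp hω).1
      omega

end IrredundantLower

/-! ### The forest of private pairs -/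

section PrivatePairs

variable {V ι : Type*} {S : ι → Finset V} {x y : ι → V}

/-- `S i` is the only member of the family `S` separating `x i` from `y i`. -/
structure PrivatePairs (S : ι → Finset V) (x y : ι → V) : Prop where
  left_mem : ∀ i, x i ∈ S i
  right_notMem : ∀ i, y i ∉ S i
  mem_iff : ∀ i j, j ≠ i → (x i ∈ S j ↔ y i ∈ S j)

/-- The graph whose edges are the pairs `x i, y i`. -/
def pairGraph (x y : ι → V) : SimpleGraph V :=
  SimpleGraph.fromRel fun u v => ∃ i, u = x i ∧ v = y i

theorem exists_of_pairGraph_adj {u v : V} (h : (pairGraph x y).Adj u v) :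
    ∃ i, s(u, v) = s(x i, y i) := by
  rw [pairGraph, SimpleGraph.fromRel_adj] at h
  rcases h.2 with ⟨i, rfl, rfl⟩ | ⟨i, rfl, rfl⟩
  · exact ⟨i, rfl⟩
  · exact ⟨i, Sym2.eq_swap⟩

theorem PrivatePairs.pairGraph_adj (h : PrivatePairs S x y) (i : ι) :
    (pairGraph x y).Adj (x i) (y i) := by
  rw [pairGraph, SimpleGraph.fromRel_adj]
  exact ⟨fun he => h.right_notMem i (he ▸ h.left_mem i), Or.inl ⟨i, rfl, rfl⟩⟩

theorem PrivatePairs.mem_iff_of_eq (h : PrivatePairs S x y) {u v : V} {i : ι}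
    (hi : s(u, v) = s(x i, y i)) (j : ι) : (u ∈ S j ↔ v ∈ S j) ↔ j ≠ i := by
  have h1 : (x i ∈ S j ↔ y i ∈ S j) ↔ j ≠ i := by
    refine ⟨?_, h.mem_iff i j⟩
    rintro h2 rfl
    exact h.right_notMem j (h2.mp (h.left_mem j))
  rcases Sym2.eq_iff.mp hi with ⟨rfl, rfl⟩ | ⟨rfl, rfl⟩
  · exact h1
  · rw [← h1]; exact iff_comm

theorem SimpleGraph.Reachable.iff_of_forall_adj {G : SimpleGraph V} {p : V → Prop}
    (hp : ∀ u v, G.Adj u v → (p u ↔ p v)) {u v : V} (h : G.Reachable u v) : p u ↔ p v := by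
  obtain ⟨w⟩ := h
  induction w with
  | nil => rfl
  | cons hadj _ ih => exact (hp _ _ hadj).trans ih

/-- Membership in `S i` is constant along every edge other than the `i`-th and changes along that
one, so each edge is a bridge. -/
theorem PrivatePairs.isAcyclic (h : PrivatePairs S x y) : (pairGraph x y).IsAcyclic := by
  rw [SimpleGraph.isAcyclic_iff_forall_adj_isBridge]
  intro u v huv
  obtain ⟨i, hi⟩ := exists_of_pairGraph_adj huv
  rw [SimpleGraph.isBridge_iff]
  intro hr
  refine (h.mem_iff_of_eq hi i).mp (hr.iff_of_forall_adj fun a b hab => ?_) rfl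
  rw [SimpleGraph.deleteEdges_adj] at hab
  obtain ⟨j, hj⟩ := exists_of_pairGraph_adj hab.1
  rw [h.mem_iff_of_eq hj]
  rintro rfl
  exact hab.2 (hj.trans hi.symm)

/-- The indicators of the sets and of the components are linearly independent: subtracting the
values of a vanishing combination at `x i` and `y i` isolates the coefficient of `S i`, and then the
disjoint components remain. -/
theorem PrivatePairs.card_add_card_connectedComponent_le [Fintype V] [Fintype ι]
    (h : PrivatePairs S x y) :
    Fintype.card ι + Nat.card (pairGraph x y).ConnectedComponent ≤ Fintype.card V := by
  classical
  have : Fintype (pairGraph x y).ConnectedComponent := Fintype.ofFinite _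
  let mk := (pairGraph x y).connectedComponentMk
  have hli : LinearIndependent ℚ (Sum.elim (fun i v => if v ∈ S i then 1 else 0)
      (fun c v => if mk v = c then 1 else 0) :
        ι ⊕ (pairGraph x y).ConnectedComponent → V → ℚ) := by
    rw [Fintype.linearIndependent_iff]
    intro g hg
    have hev : ∀ v, (∑ i, if v ∈ S i then g (Sum.inl i) else 0) + g (Sum.inr (mk v)) = 0 := by
      intro v
      have := congrFun hg v
      simpa [Fintype.sum_sum_type, Finset.sum_apply] using this
    have hl : ∀ i, g (Sum.inl i) = 0 := by
      intro i
      have h1 : mk (x i) = mk (y i) :=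
        SimpleGraph.ConnectedComponent.sound (h.pairGraph_adj i).reachable
      have h2 : (∑ j, if x i ∈ S j then g (Sum.inl j) else 0) =
          (∑ j, if y i ∈ S j then g (Sum.inl j) else 0) + g (Sum.inl i) := by
        rw [← Finset.add_sum_erase _ _ (Finset.mem_univ i),
          ← Finset.add_sum_erase (a := i) (f := fun j => if y i ∈ S j then g (Sum.inl j) else 0) _
            (Finset.mem_univ i),
          if_pos (h.left_mem i), if_neg (h.right_notMem i), zero_add, add_comm]
        congr 1
        refine Finset.sum_congr rfl fun j hj => ?_
        simp only [h.mem_iff i j (Finset.ne_of_mem_erase hj)]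
      have h3 := hev (x i)
      have h4 := hev (y i)
      rw [h1] at h3
      linarith
    rintro (i | c)
    · exact hl i
    · induction c using SimpleGraph.ConnectedComponent.ind with
      | h v => simpa [hl] using hev v
  have := hli.fintype_card_le_finrank
  rw [Nat.card_eq_fintype_card]
  simpa using this

/-- A leaf of the pair graph: flipping it in the set of its edge gives a union of components. -/
theorem PrivatePairs.exists_leaf [DecidableEq V] [Finite V] (h : PrivatePairs S x y) {u w : V}
    (hne : u ≠ w) (hr : (pairGraph x y).Reachable u w) :
    ∃ v i, (pairGraph x y).Reachable u v ∧ ∀ a b, (pairGraph x y).Reachable a b →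
      (a ∈ symmDiff (S i) {v} ↔ b ∈ symmDiff (S i) {v}) := by
  classical
  have := Fintype.ofFinite V
  let c := (pairGraph x y).connectedComponentMk u
  have hu : u ∈ c := rfl
  have hw : w ∈ c := SimpleGraph.ConnectedComponent.sound hr.symm
  have : Nontrivial c := ⟨⟨u, hu⟩, ⟨w, hw⟩, fun he => hne (congrArg Subtype.val he)⟩
  obtain ⟨⟨v, hv⟩, hdeg⟩ :=
    (h.isAcyclic.isTree_connectedComponent c).exists_vert_degree_one_of_nontrivial
  rw [SimpleGraph.degree_eq_one_iff_existsUnique_adj] at hdeg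
  obtain ⟨⟨t, ht⟩, hadj, huniq⟩ := hdeg
  have hvt : (pairGraph x y).Adj v t := hadj
  obtain ⟨i, hi⟩ := exists_of_pairGraph_adj hvt
  refine ⟨v, i, (SimpleGraph.ConnectedComponent.exact hv).symm, fun a b hab => ?_⟩
  refine hab.iff_of_forall_adj (p := fun a => a ∈ symmDiff (S i) {v}) fun a b hab => ?_
  have hleaf : ∀ b, (pairGraph x y).Adj v b → b = t := by
    intro b hb
    have hbc : b ∈ c := (SimpleGraph.ConnectedComponent.sound hb.reachable.symm).trans hv
    exact congrArg Subtype.val (huniq ⟨b, hbc⟩ hb)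
  -- Only the edge from the leaf `v` to `t` crosses `S i`; toggling `v` repairs it and affects no
  -- other edge.
  have hsep := (h.mem_iff_of_eq hi i).not.mpr (by simp)
  have htv := hvt.ne'
  simp only [Finset.mem_symmDiff, Finset.mem_singleton]
  by_cases hav : a = v
  · subst hav
    obtain rfl := hleaf b hab
    tauto
  by_cases hbv : b = v
  · subst hbv
    obtain rfl := hleaf a hab.symm
    tauto
  · obtain ⟨j, hj⟩ := exists_of_pairGraph_adj hab
    have hji : i ≠ j := by
      rintro rfl
      have h1 := hj.trans hi.symm
      rw [Sym2.eq_iff] at h1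
      tauto
    have := (h.mem_iff_of_eq hj i).mpr hji
    tauto

theorem Finset.card_symmDiff_singleton [DecidableEq V] (s : Finset V) (v : V) :
    (v ∈ s ∧ (symmDiff s {v}).card + 1 = s.card) ∨
      (v ∉ s ∧ (symmDiff s {v}).card = s.card + 1) := by
  by_cases hv : v ∈ s
  · refine Or.inl ⟨hv, ?_⟩
    rw [← Finset.card_erase_add_one hv]
    congr 2
    ext a
    simp only [Finset.mem_symmDiff, Finset.mem_singleton, Finset.mem_erase]
    by_cases ha : a = v
    · subst ha; tauto
    · tauto
  · refine Or.inr ⟨hv, ?_⟩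
    rw [← Finset.card_insert_of_notMem hv]
    congr 1
    ext a
    simp only [Finset.mem_symmDiff, Finset.mem_singleton, Finset.mem_insert]
    by_cases ha : a = v
    · subst ha; tauto
    · tauto

variable [Fintype V] {k : ℕ}

/-- In a connected graph a toggled set would be empty or everything, although its size is `k - 1` or
`k + 1`. -/
theorem PrivatePairs.exists_not_reachable (h : PrivatePairs S x y) (hS : ∀ i, (S i).card = k)
    (hk : 2 ≤ k) (hkn : 2 * k ≤ Fintype.card V) : ∃ u w, ¬ (pairGraph x y).Reachable u w := by
  classical
  by_contra! hall
  obtain ⟨u, w, hne⟩ := Fintype.exists_pair_of_one_lt_card (α := V) (by omega)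
  obtain ⟨v, i, -, hU⟩ := h.exists_leaf hne (hall u w)
  have hcard := Finset.card_symmDiff_singleton (S i) v
  rw [hS] at hcard
  by_cases hv : u ∈ symmDiff (S i) {v}
  · have : symmDiff (S i) {v} = Finset.univ :=
      Finset.eq_univ_iff_forall.mpr fun a => (hU u a (hall _ _)).mp hv
    rw [this, Finset.card_univ] at hcard
    omega
  · have : symmDiff (S i) {v} = ∅ :=
      Finset.eq_empty_iff_forall_notMem.mpr fun a ha => hv ((hU a u (hall _ _)).mp ha)
    rw [this, Finset.card_empty] at hcard
    omega

theorem PrivatePairs.card_add_two_le [Fintype ι] (h : PrivatePairs S x y)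
    (hS : ∀ i, (S i).card = k) (hk : 2 ≤ k) (hkn : 2 * k ≤ Fintype.card V) :
    Fintype.card ι + 2 ≤ Fintype.card V := by
  obtain ⟨u, w, huw⟩ := h.exists_not_reachable hS hk hkn
  have h1 := h.card_add_card_connectedComponent_le
  have : 1 < Nat.card (pairGraph x y).ConnectedComponent := by
    rw [Finite.one_lt_card_iff_nontrivial]
    exact ⟨_, _, fun he => huw (SimpleGraph.ConnectedComponent.exact he)⟩
  omega

open Classical in
-- With two components, a leaf `v` in that of `u` makes the toggled set equal to one of them. If it
-- is that of `u`, then `v` was added and the size is `k + 1`; if it is the other, `v` was removed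
-- and the other has size `k - 1`.
theorem PrivatePairs.card_component (h : PrivatePairs S x y)
    (hS : ∀ i, (S i).card = k) (hk : 3 ≤ k) (hkn : 2 * k ≤ Fintype.card V) {u w : V}
    (huw : ∀ v, (pairGraph x y).Reachable u v ↔ ¬ (pairGraph x y).Reachable w v) :
    (Finset.univ.filter fun v => (pairGraph x y).Reachable u v).card = 1 ∨
    (Finset.univ.filter fun v => (pairGraph x y).Reachable u v).card = k + 1 ∨
    (Finset.univ.filter fun v => (pairGraph x y).Reachable u v).card + k =
      Fintype.card V + 1 := by
  by_cases hs : ∃ t, u ≠ t ∧ (pairGraph x y).Reachable u t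
  · right
    obtain ⟨t, hne, hr⟩ := hs
    obtain ⟨v, i, huv, hU⟩ := h.exists_leaf hne hr
    have hcard := Finset.card_symmDiff_singleton (S i) v
    rw [hS] at hcard
    have hmem : ∀ a, (pairGraph x y).Reachable u a ∧
          (a ∈ symmDiff (S i) {v} ↔ u ∈ symmDiff (S i) {v}) ∨
        ¬ (pairGraph x y).Reachable u a ∧
          (a ∈ symmDiff (S i) {v} ↔ w ∈ symmDiff (S i) {v}) := by
      intro a
      by_cases ha : (pairGraph x y).Reachable u a
      · exact Or.inl ⟨ha, (hU u a ha).symm⟩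
      · exact Or.inr ⟨ha, (hU w a (not_not.mp ((huw a).not.mp ha))).symm⟩
    have hvS : v ∈ symmDiff (S i) {v} ↔ v ∉ S i := by simp [Finset.mem_symmDiff]
    have huvS := (hU u v huv).trans hvS
    have hsum := Finset.card_filter_add_card_filter_not (s := (Finset.univ : Finset V))
      (fun v => (pairGraph x y).Reachable u v)
    rw [Finset.card_univ] at hsum
    by_cases h1 : u ∈ symmDiff (S i) {v} <;> by_cases h2 : w ∈ symmDiff (S i) {v}
    · have : symmDiff (S i) {v} = Finset.univ := by
        ext a
        rcases hmem a with ⟨ha, he⟩ | ⟨ha, he⟩ <;> simp [he, h1, h2]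
      rw [this, Finset.card_univ] at hcard
      omega
    · have : symmDiff (S i) {v} =
          Finset.univ.filter fun v => (pairGraph x y).Reachable u v := by
        ext a
        rcases hmem a with ⟨ha, he⟩ | ⟨ha, he⟩ <;> simp [he, h1, h2, ha]
      rw [this] at hcard
      have := huvS.mp h1
      exact Or.inl (hcard.resolve_left fun hc => this hc.1).2
    · have : symmDiff (S i) {v} =
          Finset.univ.filter fun v => ¬ (pairGraph x y).Reachable u v := by
        ext a
        rcases hmem a with ⟨ha, he⟩ | ⟨ha, he⟩ <;> simp [he, h1, h2, ha]
      rw [this] at hcard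
      have := huvS.not.mp h1
      right
      rcases hcard with hcard | hcard
      · omega
      · exact absurd hcard.1 this
    · have : symmDiff (S i) {v} = ∅ := by
        ext a
        rcases hmem a with ⟨ha, he⟩ | ⟨ha, he⟩ <;> simp [he, h1, h2]
      rw [this, Finset.card_empty] at hcard
      omega
  · left
    rw [Finset.card_eq_one]
    refine ⟨u, ?_⟩
    ext a
    simp only [Finset.mem_filter, Finset.mem_univ, true_and, Finset.mem_singleton]
    refine ⟨fun ha => by_contra fun hne => hs ⟨a, Ne.symm hne, ha⟩, ?_⟩
    rintro rfl
    exact SimpleGraph.Reachable.refl _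

theorem PrivatePairs.card_eq_of_card_add_two_eq [Fintype ι] (h : PrivatePairs S x y)
    (hS : ∀ i, (S i).card = k) (hk : 3 ≤ k) (hkn : 2 * k ≤ Fintype.card V)
    (hι : Fintype.card ι + 2 = Fintype.card V) : Fintype.card V = 2 * k + 2 := by
  classical
  obtain ⟨u, w, huw⟩ := h.exists_not_reachable hS (by omega) hkn
  have h1 := h.card_add_card_connectedComponent_le
  have hcover : ∀ v, (pairGraph x y).Reachable u v ↔ ¬ (pairGraph x y).Reachable w v := by
    intro v
    refine ⟨fun h1 h2 => huw (h1.trans h2.symm), fun hwv => ?_⟩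
    by_contra huv
    have : Fintype (pairGraph x y).ConnectedComponent := Fintype.ofFinite _
    have h3 : 2 < Fintype.card (pairGraph x y).ConnectedComponent := by
      rw [Fintype.two_lt_card_iff]
      let mk := (pairGraph x y).connectedComponentMk
      exact ⟨mk u, mk w, mk v, fun he => huw (SimpleGraph.ConnectedComponent.exact he),
        fun he => huv (SimpleGraph.ConnectedComponent.exact he),
        fun he => hwv (SimpleGraph.ConnectedComponent.exact he)⟩
    rw [Nat.card_eq_fintype_card] at h1
    omega
  have hu := h.card_component hS hk hkn hcover
  have hw := h.card_component hS hk hkn (u := w) (w := u) fun v => by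
    rw [hcover v, not_not]
  have hsum := Finset.card_filter_add_card_filter_not (s := (Finset.univ : Finset V))
      (fun v => (pairGraph x y).Reachable u v)
  have heq : (Finset.univ.filter fun v => ¬ (pairGraph x y).Reachable u v) =
      Finset.univ.filter fun v => (pairGraph x y).Reachable w v := by
    ext a; simp [hcover a]
  rw [Finset.card_univ, heq] at hsum
  -- Two sizes from `1`, `k + 1`, `n - k + 1` with sum `n` must both be `k + 1`, because `k ≥ 3` and
  -- `2k ≤ n`.
  omega

end PrivatePairs

/-! ### Bounds for independent sets and extremal minimal bases -/

section MinimalBases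

variable {n k : ℕ}

theorem IsIndependentSet.exists_privatePairs {Λ : Set (Set.powersetCard (Fin n) k)}
    (h : IsIndependentSet (Equiv.Perm (Fin n)) Λ) :
    ∃ x y, PrivatePairs (fun A : Λ => (A.1 : Finset (Fin n))) x y := by
  rw [isIndependentSet_iff] at h
  choose x y hx hy hxy using h
  exact ⟨fun A => x A.1 A.2, fun A => y A.1 A.2, fun A => hx A.1 A.2, fun A => hy A.1 A.2,
    fun A B hne => hxy A.1 A.2 B.1 B.2 fun he => hne (Subtype.ext he)⟩

theorem IsIndependentSet.card_lt (hn : 0 < n) {Λ : Finset (Set.powersetCard (Fin n) k)}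
    (h : IsIndependentSet (Equiv.Perm (Fin n)) (Λ : Set (Set.powersetCard (Fin n) k))) :
    Λ.card < n := by
  obtain ⟨x, y, hp⟩ := h.exists_privatePairs
  have h1 := hp.card_add_card_connectedComponent_le
  have : Nonempty (pairGraph x y).ConnectedComponent :=
    ⟨(pairGraph x y).connectedComponentMk ⟨0, hn⟩⟩
  have h2 := Nat.card_pos (α := (pairGraph x y).ConnectedComponent)
  simp only [Finset.coe_sort_coe, Fintype.card_coe, Fintype.card_fin] at h1
  omega

theorem IsIndependentSet.card_add_two_le (hk : 2 ≤ k) (hkn : 2 * k ≤ n)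
    {Λ : Finset (Set.powersetCard (Fin n) k)}
    (h : IsIndependentSet (Equiv.Perm (Fin n)) (Λ : Set (Set.powersetCard (Fin n) k))) :
    Λ.card + 2 ≤ n := by
  obtain ⟨x, y, hp⟩ := h.exists_privatePairs
  simpa using hp.card_add_two_le (fun A => A.1.2) hk (by simpa using hkn)

theorem IsIndependentSet.card_add_two_ne (hk : 3 ≤ k) (hkn : 2 * k ≤ n) (hne : n ≠ 2 * k + 2)
    {Λ : Finset (Set.powersetCard (Fin n) k)}
    (h : IsIndependentSet (Equiv.Perm (Fin n)) (Λ : Set (Set.powersetCard (Fin n) k))) :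
    Λ.card + 2 ≠ n := by
  obtain ⟨x, y, hp⟩ := h.exists_privatePairs
  intro hc
  refine hne ?_
  simpa using hp.card_eq_of_card_add_two_eq (fun A => A.1.2) hk (by simpa using hkn)
    (by simpa using hc)

/-- Sets `S i` of size `k` which separate all points, with `S i` the only one separating `i` from
`c i`, form a minimal base. -/
theorem exists_isMinimalBase_of_family {b : ℕ} (I : Finset (Fin n)) (S : Fin n → Finset (Fin n))
    (c : Fin n → Fin n) (hI : I.card = b) (hcard : ∀ i ∈ I, (S i).card = k)
    (hself : ∀ i ∈ I, i ∈ S i ↔ c i ∉ S i)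
    (hother : ∀ i ∈ I, ∀ j ∈ I, j ≠ i → (i ∈ S j ↔ c i ∈ S j))
    (hsep : ∀ u v, (∀ i ∈ I, u ∈ S i ↔ v ∈ S i) → u = v) :
    ∃ Λ : Finset (Set.powersetCard (Fin n) k),
      IsMinimalBase (Equiv.Perm (Fin n)) (Λ : Set (Set.powersetCard (Fin n) k)) ∧
        Λ.card = b := by
  classical
  let A : I → Set.powersetCard (Fin n) k := fun i => ⟨S i, hcard i i.2⟩
  have hA : ∀ i u, u ∈ A i ↔ u ∈ S i := fun i u => Set.powersetCard.mem_coe_iff.symm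
  have hinj : Function.Injective A := by
    intro i j hij
    by_contra hne
    have h1 := hother i i.2 j j.2 fun he => hne (Subtype.ext he.symm)
    rw [← hA, ← hA, ← hij, hA, hA] at h1
    have := hself i i.2
    tauto
  refine ⟨Finset.univ.image A, ?_, ?_⟩
  · rw [isMinimalBase_iff, isActionBase_iff, isIndependentSet_iff]
    simp only [Indisting, Finset.coe_image, Finset.coe_univ, Set.image_univ, Set.forall_mem_range,
      hA]
    refine ⟨fun u v h => hsep u v fun i hi => h ⟨i, hi⟩, fun i => ?_⟩
    have hB : ∀ j, A j ≠ A i → (i.1 ∈ S j ↔ c i ∈ S j) := fun j hj =>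
      hother i i.2 j j.2 fun he => hj (congrArg A (Subtype.ext he))
    by_cases hi : i.1 ∈ S i
    · exact ⟨i, c i, hi, (hself i i.2).mp hi, hB⟩
    · exact ⟨c i, i, not_not.mp ((hself i i.2).not.mp hi), hi, fun j hj => (hB j hj).symm⟩
  · rw [Finset.card_image_of_injective _ hinj, Finset.card_univ, Fintype.card_coe, hI]

theorem exists_isMinimalBase_card_sub_one (hn : 0 < n) :
    ∃ Λ : Finset (Set.powersetCard (Fin n) 1),
      IsMinimalBase (Equiv.Perm (Fin n)) (Λ : Set (Set.powersetCard (Fin n) 1)) ∧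
        Λ.card = n - 1 := by
  refine exists_isMinimalBase_of_family (n := n) (k := 1) (Finset.univ.erase ⟨0, hn⟩)
    (fun i => {i}) (fun _ => ⟨0, hn⟩) (by simp) (by simp) (by simp; tauto) (by simp; tauto) ?_
  · intro u v h
    by_contra hne
    have h1 := h u
    have h2 := h v
    simp only [Finset.mem_erase, Finset.mem_univ, Finset.mem_singleton] at h1 h2
    by_cases hu : u = ⟨0, hn⟩
    · have : v ≠ ⟨0, hn⟩ := fun hv => hne (hu.trans hv.symm)
      tauto
    · tauto

theorem exists_isMinimalBase_card_sub_two_of_two (hn : 4 ≤ n) :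
    ∃ Λ : Finset (Set.powersetCard (Fin n) 2),
      IsMinimalBase (Equiv.Perm (Fin n)) (Λ : Set (Set.powersetCard (Fin n) 2)) ∧
        Λ.card = n - 2 := by
  -- The pair graph is a star centred at `n - 1` plus the isolated point `0`.
  refine exists_isMinimalBase_of_family (n := n) (k := 2)
    (Finset.univ \ {⟨0, by omega⟩, ⟨n - 1, by omega⟩})
    (fun i => {⟨0, by omega⟩, i}) (fun _ => ⟨n - 1, by omega⟩) ?_ ?_ ?_ ?_ ?_
  · rw [Finset.card_sdiff_of_subset (Finset.subset_univ _), Finset.card_pair, Finset.card_fin]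
    simp [Fin.ext_iff]; omega
  · intro i hi
    rw [Finset.card_pair]
    simp [Fin.ext_iff] at hi ⊢
    omega
  · intro i hi
    simp [Fin.ext_iff] at hi ⊢
    omega
  · intro i hi j hj hji
    simp [Fin.ext_iff] at hi hj hji ⊢
    omega
  · intro u v h
    simp only [Fin.forall_iff, Fin.ext_iff, Finset.mem_sdiff, Finset.mem_univ, Finset.mem_insert,
      Finset.mem_singleton, true_and] at h ⊢
    have h1 := h u u.2
    have h2 := h v v.2
    -- The point `0` lies in every set, so two different sets are needed to tell it from all other
    -- points.
    have h3 := h 1 (by omega)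
    have h4 := h 2 (by omega)
    have := u.2
    have := v.2
    omega

theorem exists_isMinimalBase_card_sub_two_of_eq (hk : 3 ≤ k) (hn : n = 2 * k + 2) :
    ∃ Λ : Finset (Set.powersetCard (Fin n) k),
      IsMinimalBase (Equiv.Perm (Fin n)) (Λ : Set (Set.powersetCard (Fin n) k)) ∧
        Λ.card = n - 2 := by
  -- Two blocks of size `k + 1`, each a star centred at its least point; the sets are blocks with
  -- one other point deleted.
  refine exists_isMinimalBase_of_family (n := n) (k := k)
    (Finset.univ \ {⟨0, by omega⟩, ⟨k + 1, by omega⟩})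
    (fun i => if i.val ≤ k then (Finset.Icc ⟨0, by omega⟩ ⟨k, by omega⟩).erase i
      else (Finset.Icc ⟨k + 1, by omega⟩ ⟨2 * k + 1, by omega⟩).erase i)
    (fun i => if i.val ≤ k then ⟨0, by omega⟩ else ⟨k + 1, by omega⟩) ?_ ?_ ?_ ?_ ?_
  · rw [Finset.card_sdiff_of_subset (Finset.subset_univ _), Finset.card_pair, Finset.card_fin]
    simp [Fin.ext_iff]
  · intro i hi
    split_ifs with h
    · rw [Finset.card_erase_of_mem, Fin.card_Icc]
      · simp
      · simp [Fin.le_def, h]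
    · rw [Finset.card_erase_of_mem, Fin.card_Icc]
      · simp; omega
      · simp [Fin.le_def]; omega
  · intro i hi
    simp only [Fin.ext_iff, Finset.mem_sdiff, Finset.mem_univ, Finset.mem_insert,
      Finset.mem_singleton, true_and] at hi
    split_ifs with h <;> simp [Fin.ext_iff, Fin.le_def] <;> omega
  · intro i hi j hj hji
    simp only [Fin.ext_iff, ne_eq, Finset.mem_sdiff, Finset.mem_univ, Finset.mem_insert,
      Finset.mem_singleton, true_and] at hi hj hji
    split_ifs <;> simp [Fin.ext_iff, Fin.le_def] <;> omega
  · intro u v h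
    have h' : ∀ i, i < n → ¬ (i = 0 ∨ i = k + 1) →
        ((i ≤ k → ((u.val ≠ i ∧ u.val ≤ k) ↔ (v.val ≠ i ∧ v.val ≤ k))) ∧
        (k < i → ((u.val ≠ i ∧ k + 1 ≤ u.val) ↔ (v.val ≠ i ∧ k + 1 ≤ v.val)))) := by
      intro i hi hi'
      have hu := u.2
      have hv := v.2
      have := h ⟨i, hi⟩ (by simpa [Fin.ext_iff] using hi')
      split_ifs at this with hik <;> simp [Fin.ext_iff, Fin.le_def] at this hik <;> omega
    have := u.2
    have := v.2
    have h1 := h' u u.2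
    have h2 := h' v v.2
    -- Two sets per block are needed to tell the blocks apart, as a deleted point looks like an
    -- outside one.
    have h3 := h' 1 (by omega)
    have h4 := h' 2 (by omega)
    have h5 := h' (k + 2) (by omega)
    have h6 := h' (k + 3) (by omega)
    rw [Fin.ext_iff]
    omega

theorem exists_isMinimalBase_card_sub_three (hk : 3 ≤ k) (hkn : 2 * k ≤ n) :
    ∃ Λ : Finset (Set.powersetCard (Fin n) k),
      IsMinimalBase (Equiv.Perm (Fin n)) (Λ : Set (Set.powersetCard (Fin n) k)) ∧
        Λ.card = n - 3 := by
  -- Three stars, on `{0, 1}`, `{2, …, k}` and `{k + 1, …, n - 1}`, centred at `0`, `2` and `k + 1`.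
  refine exists_isMinimalBase_of_family (n := n) (k := k)
    (Finset.univ \ {⟨0, by omega⟩, ⟨2, by omega⟩, ⟨k + 1, by omega⟩})
    (fun i => if 3 ≤ i.val ∧ i.val ≤ k then (Finset.Icc ⟨0, by omega⟩ ⟨k, by omega⟩).erase i
      else insert i (Finset.Icc ⟨2, by omega⟩ ⟨k, by omega⟩))
    (fun i => if i.val = 1 then ⟨0, by omega⟩ else if i.val ≤ k then ⟨2, by omega⟩
      else ⟨k + 1, by omega⟩) ?_ ?_ ?_ ?_ ?_
  · rw [Finset.card_sdiff_of_subset (Finset.subset_univ _), Finset.card_fin,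
      Finset.card_eq_three.mpr]
    exact ⟨_, _, _, by simp [Fin.ext_iff], by simp [Fin.ext_iff], by simp [Fin.ext_iff]; omega,
      rfl⟩
  · intro i hi
    simp only [Fin.ext_iff, Finset.mem_sdiff, Finset.mem_univ, Finset.mem_insert,
      Finset.mem_singleton, true_and] at hi
    split_ifs with h
    · rw [Finset.card_erase_of_mem, Fin.card_Icc]
      · simp
      · simp [Fin.le_def, h]
    · rw [Finset.card_insert_of_notMem, Fin.card_Icc]
      · simp; omega
      · simp [Fin.le_def]; omega
  · intro i hi
    simp only [Fin.ext_iff, Finset.mem_sdiff, Finset.mem_univ, Finset.mem_insert,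
      Finset.mem_singleton, true_and] at hi
    split_ifs <;> simp [Fin.ext_iff, Fin.le_def] <;> omega
  · intro i hi j hj hji
    simp only [Fin.ext_iff, ne_eq, Finset.mem_sdiff, Finset.mem_univ, Finset.mem_insert,
      Finset.mem_singleton, true_and] at hi hj hji
    split_ifs <;> simp [Fin.ext_iff, Fin.le_def] <;> omega
  · intro u v h
    have h' : ∀ i, i < n → ¬ (i = 0 ∨ i = 2 ∨ i = k + 1) →
        ((3 ≤ i ∧ i ≤ k → ((u.val ≠ i ∧ u.val ≤ k) ↔ (v.val ≠ i ∧ v.val ≤ k))) ∧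
        (¬ (3 ≤ i ∧ i ≤ k) → ((u.val = i ∨ (2 ≤ u.val ∧ u.val ≤ k)) ↔
          (v.val = i ∨ (2 ≤ v.val ∧ v.val ≤ k))))) := by
      intro i hi hi'
      have hu := u.2
      have hv := v.2
      have := h ⟨i, hi⟩ (by simpa [Fin.ext_iff] using hi')
      split_ifs at this with hik <;> simp [Fin.ext_iff, Fin.le_def] at this hik <;> omega
    have := u.2
    have := v.2
    have h1 := h' u u.2
    have h2 := h' v v.2
    -- One index from each star; these separate the components.
    have h3 := h' 1 (by omega)
    have h4 := h' 3 (by omega)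
    have h5 := h' (n - 1) (by omega)
    rw [Fin.ext_iff]
    omega

/-- Minimal bases are independent, so `B ≤ H`, and one construction with one bound settles both. -/
theorem maxMinimalBaseSizeEq_and_heightEq {b : ℕ}
    (hb : ∃ Λ : Finset (Set.powersetCard (Fin n) k),
      IsMinimalBase (Equiv.Perm (Fin n)) (Λ : Set (Set.powersetCard (Fin n) k)) ∧ Λ.card = b)
    (hub : ∀ Λ : Finset (Set.powersetCard (Fin n) k),
      IsIndependentSet (Equiv.Perm (Fin n)) (Λ : Set (Set.powersetCard (Fin n) k)) →
        Λ.card ≤ b) :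
    MaxMinimalBaseSizeEq (Equiv.Perm (Fin n)) (Set.powersetCard (Fin n) k) b ∧
      HeightEq (Equiv.Perm (Fin n)) (Set.powersetCard (Fin n) k) b := by
  refine ⟨⟨hb, ?_⟩, ?_, ?_⟩
  · rintro _ ⟨Λ, hΛ, rfl⟩
    exact hub Λ (isMinimalBase_iff.mp hΛ).2
  · obtain ⟨Λ, hΛ, hc⟩ := hb
    exact ⟨Λ, (isMinimalBase_iff.mp hΛ).2, hc⟩
  · rintro _ ⟨Λ, hΛ, rfl⟩
    exact hub Λ hΛ

end MinimalBases

theorem theorem1p1 (n k : ℕ) (hk : 1 ≤ k) (hkn : 2 * k ≤ n) :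
    MaxIrredundantBaseLengthEq (Equiv.Perm (Fin n)) (Set.powersetCard (Fin n) k)
      (if Nat.gcd n k = 1 then n - 1 else n - 2) ∧
    MaxMinimalBaseSizeEq (Equiv.Perm (Fin n)) (Set.powersetCard (Fin n) k)
      (if k = 1 then n - 1
        else if k = 2 ∨ (3 ≤ k ∧ n = 2 * k + 2) then n - 2
        else n - 3) ∧
    HeightEq (Equiv.Perm (Fin n)) (Set.powersetCard (Fin n) k)
      (if k = 1 then n - 1
        else if k = 2 ∨ (3 ≤ k ∧ n = 2 * k + 2) then n - 2
        else n - 3) := by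
  refine ⟨maxIrredundantBaseLengthEq_powersetCard hk hkn, ?_⟩
  split_ifs with h1 h2
  · subst h1
    refine maxMinimalBaseSizeEq_and_heightEq (exists_isMinimalBase_card_sub_one (by omega))
      fun Λ hΛ => ?_
    have := hΛ.card_lt (by omega)
    omega
  · refine maxMinimalBaseSizeEq_and_heightEq ?_ fun Λ hΛ => ?_
    · rcases h2 with rfl | ⟨h3, h4⟩
      · exact exists_isMinimalBase_card_sub_two_of_two (by omega)
      · exact exists_isMinimalBase_card_sub_two_of_eq h3 h4
    · have := hΛ.card_add_two_le (by omega) hkn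
      omega
  · refine maxMinimalBaseSizeEq_and_heightEq
      (exists_isMinimalBase_card_sub_three (by omega) hkn) fun Λ hΛ => ?_
    have := hΛ.card_add_two_le (by omega) hkn
    have := hΛ.card_add_two_ne (by omega) hkn (by omega)
    omega
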